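/- For $n\in\mathbb N$ put $N=2^n$ and let $\{|x\rangle\}_{x\in\{0,1\}^n}$ be the computational basis of $\mathbb C^N$; for a nonempty $S\subseteq\{0,1\}^n$ let $|S\rangle=|S|^{-1/2}\sum_{x\in S}|x\rangle$ be its subset state. For matrices $A,B$ of the same size let $\mathrm{TD}(A,B)=\tfrac12\|A-B\|_1$, where $\|A\|_1=\operatorname{tr}\sqrt{A^\dagger A}$ is the trace norm. Let $\mathbb E_{\phi\sim\mathrm{Haar}}\,|\phi\rangle\langle\phi|^{\otimes t}$ denote the average over a uniformly (Haar) random unit vector $\phi\in\mathbb C^N$. (i) For all $n,t\ge 0$, $$\mathbb E_{\phi\sim\mathrm{Haar}}\,|\phi\rangle\langle\phi|^{\otimes t}=\binom{N+t-1}{t}^{-1}\,\Pi_{\mathrm{sym}},$$ where $\Pi_{\mathrm{sym}}$ is the orthogonal projector of $(\mathbb C^N)^{\otimes t}$ onto its symmetric subspace, i.e. the vectors invariant under all permutations of the $t$ tensor factors. (ii) There are absolute constants $C_1,C_2>0$ such that the following holds. Let $t=t(n)$ and $m=m(n)$ be sequences of natural numbers such that $t(n)=O(n^k)$ for some $k$,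 $n^k=o(m(n))$ for every $k$, and $m(n)=o(2^n)$. Then for all sufficiently large $n$, $$\mathrm{TD}\Big(\mathbb E_{S}\,|S\rangle\langle S|^{\otimes t},\ \mathbb E_{\phi\sim\mathrm{Haar}}\,|\phi\rangle\langle\phi|^{\otimes t}\Big)\le C_1\,\frac{tm}{N}+C_2\,\frac{t^2}{m},$$ where $S$ is uniformly random among the $m$-element subsets of $\{0,1\}^n$. -/

import Mathlib

open MeasureTheory Filter Asymptotics
open scoped Matrix Topology

noncomputable section

namespace SubsetState

/-- The rank-one operator `|ψ⟩⟨ψ|` of a vector of the Hilbert space with orthonormal basis `X`. -/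
def dyad {X : Type} (ψ : EuclideanSpace ℂ X) : Matrix X X ℂ :=
  Matrix.of fun x y => ψ x * star (ψ y)

/-- The `t`-fold tensor power `A ⊗ ⋯ ⊗ A` of a matrix, in the computational basis
`|x₁, …, x_t⟩` of the `t`-fold tensor power of the Hilbert space with basis `X`. -/
def tensorPow {X : Type} (A : Matrix X X ℂ) (t : ℕ) : Matrix (Fin t → X) (Fin t → X) ℂ :=
  Matrix.of fun x y => ∏ i, A (x i) (y i)

/-- The subset state `|S⟩ = |S|^{-1/2} ∑_{x ∈ S} |x⟩`. -/
def subsetState {X : Type} [DecidableEq X] (S : Finset X) : EuclideanSpace ℂ X :=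
  WithLp.toLp 2 fun x => if x ∈ S then (((Real.sqrt (S.card : ℝ))⁻¹ : ℝ) : ℂ) else 0

/-- The average of `|S⟩⟨S|^{⊗t}` over a uniformly random `m`-element subset `S` of `X`. -/
def subsetAverage (X : Type) [Fintype X] [DecidableEq X] (m t : ℕ) :
    Matrix (Fin t → X) (Fin t → X) ℂ :=
  ((Finset.powersetCard m (Finset.univ : Finset X)).card : ℂ)⁻¹ •
    ∑ S ∈ Finset.powersetCard m (Finset.univ : Finset X), tensorPow (dyad (subsetState S)) t

/-- Lebesgue measure on the Hilbert space `ℂ^X`. -/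
def lebesgue (X : Type) [Fintype X] : Measure (EuclideanSpace ℂ X) :=
  (volume : Measure (X → ℂ)).map (WithLp.toLp 2)

/-- The Haar measure on pure states: the uniform (normalized, unitarily invariant) probability
measure on the unit sphere of `ℂ^X`. -/
def haarState (X : Type) [Fintype X] : Measure (Metric.sphere (0 : EuclideanSpace ℂ X) 1) :=
  ((lebesgue X).toSphere Set.univ)⁻¹ • (lebesgue X).toSphere

/-- The `t`-copy Haar average of `|φ⟩⟨φ|^{⊗t}`, entry by entry. -/
def haarAverage (X : Type) [Fintype X] (t : ℕ) : Matrix (Fin t → X) (Fin t → X) ℂ :=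
  Matrix.of fun x y => ∫ φ, tensorPow (dyad (φ : EuclideanSpace ℂ X)) t x y ∂(haarState X)

/-- The symmetric subspace of the `t`-fold tensor power of `ℂ^X`: the vectors that are invariant
under all permutations of the `t` tensor factors. -/
def symSubspace (X : Type) (t : ℕ) : Submodule ℂ (EuclideanSpace ℂ (Fin t → X)) where
  carrier := {v | ∀ (σ : Equiv.Perm (Fin t)) (x : Fin t → X), v (x ∘ σ) = v x}
  add_mem' := by
    intro v w hv hw σ x
    simp [hv σ x, hw σ x]
  zero_mem' := by
    intro σ x
    simp
  smul_mem' := by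
    intro c v hv σ x
    simp [hv σ x]

/-- The trace norm `‖A‖₁ = tr √(A† A)`: the sum of the singular values of `A`. -/
def traceNorm {Y : Type} [Fintype Y] [DecidableEq Y] (A : Matrix Y Y ℂ) : ℝ :=
  ∑ i, Real.sqrt ((Matrix.isHermitian_conjTranspose_mul_self A).eigenvalues i)

/-- The trace distance `½ ‖A - B‖₁`. -/
def traceDistance {Y : Type} [Fintype Y] [DecidableEq Y] (A B : Matrix Y Y ℂ) : ℝ :=
  traceNorm (A - B) / 2

end SubsetState

end

/-! For (i), the integral over the sphere of a homogeneous polynomial is, up to a Gamma factor, its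
Gaussian integral over `ℂ^N`, which factors over coordinates. The entry at tuples `x`, `y` is thus a
constant times the number of permutations carrying `x` to `y`, and this is the matrix of the
symmetrizer.

For (ii), let `ρ`, `σ` be the two averages and `V` a subspace with projector `P`. If `ρ ≥ μP` and `σ
≥ μP`, then `±(ρ - σ) ≤ ρ + σ - 2μP`, and since both traces are 1 the trace distance is at most `1 -
μ dim V` (`traceNorm_sub_le`). It remains to find `V` with `μ dim V` close to 1.

An entry of `ρ` depends only on the size of the union of the two supports, so `ρ` is of
Johnson-scheme type. Take `V` to be the top harmonic space: functions on `t`-subsets whose sums over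
the supersets of every `(t-1)`-subset vanish. Then `V` lies in the symmetric subspace, has dimension
at least `C(N,t) - C(N,t-1)`, and is an eigenspace of `ρ` with an explicit eigenvalue
(`subsetAverage_apply_of_mem_harmonicSubspace`). The two candidates for `μ` are this eigenvalue and
the Haar value `1 / C(N+t-1,t)`; Bernoulli's inequality bounds both products (`one_sub_le_min_mul`).
-/

namespace SubsetState

/-! ### Trace norm bounds from operator inequalities. -/

section TraceNorm

open scoped ComplexOrder

variable {Y : Type} [Fintype Y] [DecidableEq Y]

/-- Comparing characteristic polynomials identifies the eigenvalues of `Aᴴ * A` with the squares of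
those of `A` as multisets, so no matching of the two enumerations is needed. -/
theorem charpoly_conjTranspose_mul_self {A : Matrix Y Y ℂ} (hA : A.IsHermitian) :
    (Aᴴ * A).charpoly =
      ∏ i, (Polynomial.X - Polynomial.C (((hA.eigenvalues i ^ 2 : ℝ)) : ℂ)) := by
  have h : Aᴴ * A = Unitary.conjStarAlgAut ℂ _ hA.eigenvectorUnitary
      (Matrix.diagonal fun i => ((hA.eigenvalues i ^ 2 : ℝ) : ℂ)) := by
    rw [hA.eq]
    conv_lhs => rw [hA.spectral_theorem]
    rw [← map_mul, Matrix.diagonal_mul_diagonal]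
    congr 2
    ext i
    simp [sq]
  rw [h, Unitary.conjStarAlgAut_apply, Matrix.charpoly_mul_comm, ← mul_assoc]
  simp [Matrix.charpoly_diagonal]

/-- The trace norm of a Hermitian matrix is the sum of the absolute values of its eigenvalues. -/
theorem traceNorm_eq_sum_abs_eigenvalues {A : Matrix Y Y ℂ} (hA : A.IsHermitian) :
    traceNorm A = ∑ i, |hA.eigenvalues i| := by
  have h := congrArg Polynomial.roots (charpoly_conjTranspose_mul_self hA)
  rw [(Matrix.isHermitian_conjTranspose_mul_self A).roots_charpoly_eq_eigenvalues,
    Polynomial.roots_prod _ _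
      (Finset.prod_ne_zero_iff.2 fun i _ => Polynomial.X_sub_C_ne_zero _)] at h
  have h2 := congrArg (fun s : Multiset ℂ => (s.map fun z => Real.sqrt z.re).sum) h
  simp only [Polynomial.roots_X_sub_C, Multiset.bind_singleton, Multiset.map_map] at h2
  simp only [Function.comp_def, Complex.coe_algebraMap, Complex.ofReal_re,
    Real.sqrt_sq_eq_abs] at h2
  exact h2

/-- In an eigenbasis of `A` the hypothesis bounds each `|λᵢ|` by a diagonal entry of `Q`, and these
entries sum to the trace. -/
theorem traceNorm_le_re_trace {A : Matrix Y Y ℂ} (hA : A.IsHermitian)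
    (Q : EuclideanSpace ℂ Y →ₗ[ℂ] EuclideanSpace ℂ Y)
    (h : ∀ w, |(inner ℂ w (Matrix.toEuclideanCLM (𝕜 := ℂ) A w)).re| ≤ (inner ℂ w (Q w)).re) :
    traceNorm A ≤ (LinearMap.trace ℂ _ Q).re := by
  rw [traceNorm_eq_sum_abs_eigenvalues hA,
    LinearMap.trace_eq_sum_inner Q hA.eigenvectorBasis, Complex.re_sum]
  refine Finset.sum_le_sum fun i _ => ?_
  refine le_trans (le_of_eq ?_) (h (hA.eigenvectorBasis i))
  rw [hA.eigenvalues_eq i, EuclideanSpace.inner_eq_star_dotProduct, dotProduct_comm]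
  rfl

theorem trace_toEuclideanCLM (A : Matrix Y Y ℂ) :
    LinearMap.trace ℂ _ (Matrix.toEuclideanCLM (𝕜 := ℂ) A).toLinearMap = A.trace := by
  rw [LinearMap.trace_eq_sum_inner _ (EuclideanSpace.basisFun Y ℂ), Matrix.trace]
  refine Finset.sum_congr rfl fun i _ => ?_
  simp [EuclideanSpace.inner_single_left, Matrix.ofLp_toEuclideanCLM]

theorem trace_starProjection {E : Type*} [NormedAddCommGroup E] [InnerProductSpace ℂ E]
    [FiniteDimensional ℂ E] (V : Submodule ℂ E) :
    LinearMap.trace ℂ E V.starProjection.toLinearMap = Module.finrank ℂ V := by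
  refine LinearMap.IsProj.trace (p := V) ⟨fun x => V.starProjection_apply_mem x, fun x hx => ?_⟩
  exact Submodule.starProjection_eq_self_iff.2 hx

/-- Two Hermitian matrices that both dominate `μ` times the projector onto `V` are close in trace
norm when their traces are close to `μ * dim V`. -/
theorem traceNorm_sub_le {ρ σ : Matrix Y Y ℂ} (hρ : ρ.IsHermitian) (hσ : σ.IsHermitian)
    (V : Submodule ℂ (EuclideanSpace ℂ Y)) (μ : ℝ)
    (h₁ : ∀ w, μ * ‖V.starProjection w‖ ^ 2 ≤
      (inner ℂ w (Matrix.toEuclideanCLM (𝕜 := ℂ) ρ w)).re)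
    (h₂ : ∀ w, μ * ‖V.starProjection w‖ ^ 2 ≤
      (inner ℂ w (Matrix.toEuclideanCLM (𝕜 := ℂ) σ w)).re) :
    traceNorm (ρ - σ) ≤ ρ.trace.re + σ.trace.re - 2 * (μ * Module.finrank ℂ V) := by
  -- The majorant `ρ + σ - 2μP` exceeds `ρ - σ` by `2(σ - μP)` and `σ - ρ` by `2(ρ - μP)`.
  have key := traceNorm_le_re_trace (hρ.sub hσ)
    ((Matrix.toEuclideanCLM (𝕜 := ℂ) ρ).toLinearMap +
      (Matrix.toEuclideanCLM (𝕜 := ℂ) σ).toLinearMap -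
      ((2 * μ : ℝ) : ℂ) • V.starProjection.toLinearMap) ?_
  · refine key.trans (le_of_eq ?_)
    rw [map_sub, map_add, map_smul, trace_toEuclideanCLM, trace_toEuclideanCLM,
      trace_starProjection]
    simp
    ring
  · intro w
    have hP : (inner ℂ w (V.starProjection w)).re = ‖V.starProjection w‖ ^ 2 := by
      have := Submodule.re_inner_starProjection_eq_normSq V w
      rw [← inner_conj_symm, Complex.conj_re]
      simpa using this
    have e1 : (inner ℂ w (Matrix.toEuclideanCLM (𝕜 := ℂ) (ρ - σ) w)).re =
        (inner ℂ w (Matrix.toEuclideanCLM (𝕜 := ℂ) ρ w)).re -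
        (inner ℂ w (Matrix.toEuclideanCLM (𝕜 := ℂ) σ w)).re := by
      simp [map_sub]
    have e2 : (inner ℂ w (((Matrix.toEuclideanCLM (𝕜 := ℂ) ρ).toLinearMap +
        (Matrix.toEuclideanCLM (𝕜 := ℂ) σ).toLinearMap -
        ((2 * μ : ℝ) : ℂ) • V.starProjection.toLinearMap) w)).re =
        (inner ℂ w (Matrix.toEuclideanCLM (𝕜 := ℂ) ρ w)).re +
        (inner ℂ w (Matrix.toEuclideanCLM (𝕜 := ℂ) σ w)).re -
        2 * (μ * ‖V.starProjection w‖ ^ 2) := by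
      simp only [LinearMap.sub_apply, LinearMap.add_apply, LinearMap.smul_apply,
        ContinuousLinearMap.coe_coe, inner_sub_right, inner_add_right, inner_smul_right,
        Complex.sub_re, Complex.add_re, Complex.re_ofReal_mul, hP]
      ring
    rw [e1, e2, abs_le]
    constructor <;> linarith [h₁ w, h₂ w]

/-- A positive semidefinite operator dominates `μ` times the projector onto a subspace of an
eigenspace, for every `μ` that is at most the eigenvalue. -/
theorem le_re_inner_of_eigenspace {ρ : Matrix Y Y ℂ} (hρ : ρ.PosSemidef)
    (V : Submodule ℂ (EuclideanSpace ℂ Y)) (lam μ : ℝ) (hμ : μ ≤ lam)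
    (hV : ∀ v ∈ V, Matrix.toEuclideanCLM (𝕜 := ℂ) ρ v = (lam : ℂ) • v)
    (w : EuclideanSpace ℂ Y) :
    μ * ‖V.starProjection w‖ ^ 2 ≤ (inner ℂ w (Matrix.toEuclideanCLM (𝕜 := ℂ) ρ w)).re := by
  set T := Matrix.toEuclideanCLM (𝕜 := ℂ) ρ with hT
  set v := V.starProjection w with hv
  have hvV : v ∈ V := V.starProjection_apply_mem w
  -- Split `w = v + u` along `V` and its complement. The cross terms vanish because `T` is symmetric
  -- and scales `v`; the `u` term is nonnegative.
  obtain ⟨u, hu⟩ : ∃ u, u = w - v := ⟨_, rfl⟩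
  have huV : u ∈ Vᗮ := hu ▸ V.sub_starProjection_mem_orthogonal w
  have hw : w = v + u := by rw [hu]; abel
  have hsym : inner ℂ v (T u) = inner ℂ (T v) u := by
    have := (Matrix.isSymmetric_toEuclideanLin_iff.mpr hρ.1) v u
    exact this.symm
  have hpos : 0 ≤ (inner ℂ u (T u)).re := by
    have := hρ.re_dotProduct_nonneg u.ofLp
    rw [hT, EuclideanSpace.inner_eq_star_dotProduct, dotProduct_comm]
    exact this
  have h0 : inner ℂ v u = 0 := (Submodule.mem_orthogonal V u).1 huV v hvV
  have h0' : inner ℂ u v = 0 := by rw [← inner_conj_symm, h0, map_zero]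
  have hvv : (inner ℂ v v).re = ‖v‖ ^ 2 := by
    simpa using inner_self_eq_norm_sq (𝕜 := ℂ) v
  rw [hw]
  simp only [map_add, inner_add_left, inner_add_right, hsym, hV v hvV, inner_smul_left,
    inner_smul_right, h0, h0', mul_zero, Complex.add_re, Complex.re_ofReal_mul, hvv,
    Complex.zero_re]
  nlinarith [sq_nonneg ‖v‖]

end TraceNorm

/-! ### Gaussian moments on the complex plane. -/

section Gaussian

theorem integral_pow_mul_conj_pow_mul_exp_of_ne {k l : ℕ} (hkl : k ≠ l) :
    ∫ z : ℂ, z ^ k * star z ^ l * (Real.exp (-‖z‖ ^ 2) : ℂ) = 0 := by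
  -- Rotation by this angle multiplies `z ^ k * star z ^ l` by `exp(iθ(k - l)) = -1`, so the
  -- integral equals its own negative.
  set θ : ℝ := Real.pi / ((k : ℝ) - l) with hθ
  have hne : (k : ℝ) - l ≠ 0 := sub_ne_zero.2 (by exact_mod_cast hkl)
  have h := (rotation (Circle.exp θ)).measurePreserving.integral_comp
    (rotation (Circle.exp θ)).toHomeomorph.measurableEmbedding
    (fun z : ℂ => z ^ k * star z ^ l * (Real.exp (-‖z‖ ^ 2) : ℂ))
  have hc : (Circle.exp θ : ℂ) ^ k * star (Circle.exp θ : ℂ) ^ l = -1 := by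
    rw [Circle.coe_exp, Complex.star_def, ← Complex.exp_conj, ← Complex.exp_nat_mul,
      ← Complex.exp_nat_mul, ← Complex.exp_add, ← Complex.exp_pi_mul_I]
    congr 1
    have : (Real.pi : ℂ) = θ * (k - l) := by
      rw [hθ]
      have : ((k : ℂ) - l) ≠ 0 := by exact_mod_cast hne
      push_cast
      field_simp
    rw [this]
    simp
    ring
  have h2 : (fun z : ℂ => (rotation (Circle.exp θ) z) ^ k * star (rotation (Circle.exp θ) z) ^ l *
      (Real.exp (-‖rotation (Circle.exp θ) z‖ ^ 2) : ℂ)) =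
      fun z : ℂ => -(z ^ k * star z ^ l * (Real.exp (-‖z‖ ^ 2) : ℂ)) := by
    funext z
    rw [LinearIsometryEquiv.norm_map, rotation_apply, star_mul', mul_pow, mul_pow]
    linear_combination (z ^ k * star z ^ l * (Real.exp (-‖z‖ ^ 2) : ℂ)) * hc
  rw [h2, integral_neg] at h
  exact self_eq_neg.1 h.symm

theorem integral_pow_mul_conj_pow_mul_exp_self (k : ℕ) :
    ∫ z : ℂ, z ^ k * star z ^ k * (Real.exp (-‖z‖ ^ 2) : ℂ) = Real.pi * (k.factorial : ℂ) := by
  have h := Complex.integral_rpow_mul_exp_neg_rpow (p := 2) (q := 2 * k) (by norm_num)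
    (by have : (0 : ℝ) ≤ k := k.cast_nonneg
        linarith)
  have e : (2 * (k : ℝ) + 2) / 2 = k + 1 := by ring
  rw [e, Real.Gamma_nat_eq_factorial] at h
  have h2 : (fun z : ℂ => z ^ k * star z ^ k * (Real.exp (-‖z‖ ^ 2) : ℂ)) =
      fun z : ℂ => ((‖z‖ ^ (2 * (k : ℝ)) * Real.exp (-‖z‖ ^ (2 : ℝ)) : ℝ) : ℂ) := by
    funext z
    rw [← mul_pow, Complex.star_def, Complex.mul_conj, Complex.normSq_eq_norm_sq, Real.rpow_mul
      (norm_nonneg z), Real.rpow_natCast, Real.rpow_two]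
    push_cast
    ring
  rw [h2, integral_complex_ofReal, h]
  push_cast
  ring

theorem integral_pow_mul_conj_pow_mul_exp (k l : ℕ) :
    ∫ z : ℂ, z ^ k * star z ^ l * (Real.exp (-‖z‖ ^ 2) : ℂ) =
      if k = l then Real.pi * (k.factorial : ℂ) else 0 := by
  split_ifs with h
  · rw [← h, integral_pow_mul_conj_pow_mul_exp_self]
  · exact integral_pow_mul_conj_pow_mul_exp_of_ne h

end Gaussian

/-! ### Passage from Gaussian to spherical integrals. -/

section Polar

variable {E : Type*} [NormedAddCommGroup E] [NormedSpace ℝ E] [MeasurableSpace E] [BorelSpace E]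
  [FiniteDimensional ℝ E] [Nontrivial E]

/-- Gaussian integrals of homogeneous functions in polar coordinates. -/
theorem integral_mul_exp_eq_integral_toSphere (μ : Measure E) [μ.IsAddHaarMeasure] (f : E → ℂ)
    (d : ℕ) (hf : ∀ (r : ℝ) (x : E), 0 < r → f (r • x) = (r : ℂ) ^ d * f x) :
    ∫ x, f x * (Real.exp (-‖x‖ ^ 2) : ℂ) ∂μ =
      (∫ u : Metric.sphere (0 : E) 1, f u ∂μ.toSphere) *
        ((Real.Gamma ((Module.finrank ℝ E + d : ℕ) / 2) / 2 : ℝ) : ℂ) := by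
  have hpos : 0 < Module.finrank ℝ E := Module.finrank_pos
  set D := Module.finrank ℝ E with hD
  calc
    ∫ x, f x * (Real.exp (-‖x‖ ^ 2) : ℂ) ∂μ
      = ∫ x : ({(0)}ᶜ : Set E), f x.1 * (Real.exp (-‖x.1‖ ^ 2) : ℂ) ∂(μ.comap (↑)) := by
      rw [integral_subtype_comap (measurableSet_singleton _).compl
        fun x ↦ f x * (Real.exp (-‖x‖ ^ 2) : ℂ), restrict_compl_singleton]
    _ = ∫ p : Metric.sphere (0 : E) 1 × Set.Ioi (0 : ℝ), f p.1 *
        (((p.2 : ℝ) ^ d * Real.exp (-(p.2 : ℝ) ^ 2) : ℝ) : ℂ)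
        ∂μ.toSphere.prod (.volumeIoiPow (D - 1)) := by
      rw [← μ.measurePreserving_homeomorphUnitSphereProd.integral_comp
        (Homeomorph.measurableEmbedding _)]
      refine integral_congr_ae (Eventually.of_forall fun x => ?_)
      have hx : 0 < ‖x.1‖ := norm_pos_iff.2 x.2
      simp only [homeomorphUnitSphereProd_apply_fst_coe, homeomorphUnitSphereProd_apply_snd_coe]
      have := hf ‖x.1‖ (‖x.1‖⁻¹ • x.1) hx
      rw [smul_inv_smul₀ hx.ne'] at this
      rw [this]
      push_cast
      ring
    _ = (∫ u : Metric.sphere (0 : E) 1, f u ∂μ.toSphere) *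
        ∫ r : Set.Ioi (0 : ℝ), (((r : ℝ) ^ d * Real.exp (-(r : ℝ) ^ 2) : ℝ) : ℂ)
          ∂.volumeIoiPow (D - 1) :=
      integral_prod_mul (fun u : Metric.sphere (0 : E) 1 => f u)
        (fun r : Set.Ioi (0 : ℝ) => (((r : ℝ) ^ d * Real.exp (-(r : ℝ) ^ 2) : ℝ) : ℂ))
    _ = _ := by
      congr 1
      rw [integral_complex_ofReal]
      congr 1
      simp only [Measure.volumeIoiPow, ENNReal.ofReal]
      rw [integral_withDensity_eq_integral_smul,
        integral_subtype_comap measurableSet_Ioi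
          fun a ↦ Real.toNNReal (a ^ (D - 1)) • (a ^ d * Real.exp (-a ^ 2))]
      · have h := integral_rpow_mul_exp_neg_rpow (p := 2) (q := ((D - 1 + d : ℕ) : ℝ))
          (by norm_num) (by have : (0 : ℝ) ≤ ((D - 1 + d : ℕ) : ℝ) := Nat.cast_nonneg _
                            linarith)
        -- The polar density has exponent `D - 1`; the truncated subtraction is harmless since `D`
        -- is positive.
        have e : ((D - 1 + d : ℕ) : ℝ) + 1 = ((D + d : ℕ) : ℝ) := by
          rw [← Nat.cast_succ]
          congr 1
          omega
        rw [e] at h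
        rw [show Real.Gamma (((D + d : ℕ) : ℝ) / 2) / 2 =
          1 / 2 * Real.Gamma (((D + d : ℕ) : ℝ) / 2) by ring, ← h]
        refine setIntegral_congr_fun measurableSet_Ioi fun x hx ↦ ?_
        simp only [NNReal.smul_def, smul_eq_mul]
        rw [Real.coe_toNNReal _ (pow_nonneg hx.out.le _), Real.rpow_natCast, Real.rpow_two,
          pow_add]
        ring
      · exact (measurable_subtype_coe.pow_const _).real_toNNReal

end Polar

/-! ### Moments of the Haar random state. -/

section Haar

variable {X : Type} [Fintype X]

instance isAddHaarMeasure_lebesgue : (lebesgue X).IsAddHaarMeasure :=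
  (PiLp.continuousLinearEquiv 2 ℝ fun _ : X => ℂ).symm.isAddHaarMeasure_map _

theorem finrank_real_euclideanSpace :
    Module.finrank ℝ (EuclideanSpace ℂ X) = 2 * Fintype.card X := by
  rw [finrank_real_of_complex, finrank_euclideanSpace]

theorem integral_lebesgue (f : EuclideanSpace ℂ X → ℂ) :
    ∫ v, f v ∂(lebesgue X) = ∫ z : X → ℂ, f (WithLp.toLp 2 z) := by
  rw [lebesgue]
  exact (MeasurableEquiv.toLp 2 (X → ℂ)).measurableEmbedding.integral_map f

variable [DecidableEq X]

/-- The number of occurrences of `a` in the tuple `x`. -/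
def occurrences {t : ℕ} (x : Fin t → X) (a : X) : ℕ := Fintype.card {i // x i = a}

theorem prod_comp_eq_prod_pow_occurrences {t : ℕ} (x : Fin t → X) (z : X → ℂ) :
    ∏ i, z (x i) = ∏ a, z a ^ occurrences x a := by
  rw [← Finset.prod_fiberwise (s := Finset.univ) (g := x)]
  refine Finset.prod_congr rfl fun a _ => ?_
  rw [Finset.prod_congr rfl (g := fun _ => z a) (fun i hi => by
    rw [(Finset.mem_filter.1 hi).2]), Finset.prod_const, occurrences, Fintype.card_subtype]

omit [Fintype X] [DecidableEq X] in
theorem tensorPow_dyad_apply {t : ℕ} (ψ : EuclideanSpace ℂ X) (x y : Fin t → X) :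
    tensorPow (dyad ψ) t x y = (∏ i, ψ (x i)) * ∏ i, star (ψ (y i)) := by
  simp [tensorPow, dyad, Finset.prod_mul_distrib]

theorem integral_gaussian_tensorPow {t : ℕ} (x y : Fin t → X) :
    ∫ v : EuclideanSpace ℂ X, tensorPow (dyad v) t x y * (Real.exp (-‖v‖ ^ 2) : ℂ) ∂(lebesgue X) =
      if occurrences x = occurrences y then
        (Real.pi : ℂ) ^ Fintype.card X * ∏ a, ((occurrences x a).factorial : ℂ) else 0 := by
  rw [integral_lebesgue]
  have h : (fun z : X → ℂ => tensorPow (dyad (WithLp.toLp 2 z)) t x y *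
      (Real.exp (-‖(WithLp.toLp 2 z : EuclideanSpace ℂ X)‖ ^ 2) : ℂ)) =
      fun z : X → ℂ => ∏ a, (z a ^ occurrences x a * star (z a) ^ occurrences y a *
        (Real.exp (-‖z a‖ ^ 2) : ℂ)) := by
    funext z
    rw [tensorPow_dyad_apply, Finset.prod_mul_distrib, Finset.prod_mul_distrib,
      EuclideanSpace.norm_sq_eq, ← Finset.sum_neg_distrib, Real.exp_sum,
      prod_comp_eq_prod_pow_occurrences x z,
      prod_comp_eq_prod_pow_occurrences y fun a => star (z a)]
    push_cast
    rfl
  rw [h, integral_fintype_prod_volume_eq_prod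
    (fun a (z : ℂ) => z ^ occurrences x a * star z ^ occurrences y a *
        (Real.exp (-‖z‖ ^ 2) : ℂ))]
  simp only [integral_pow_mul_conj_pow_mul_exp]
  split_ifs with hxy
  · rw [Finset.prod_congr rfl (fun a _ => if_pos (congrFun hxy a)), Finset.prod_mul_distrib]
    simp
  · obtain ⟨a, ha⟩ := Function.ne_iff.1 hxy
    exact Finset.prod_eq_zero (Finset.mem_univ a) (if_neg ha)

omit [Fintype X] [DecidableEq X] in
theorem tensorPow_dyad_smul {t : ℕ} (x y : Fin t → X) (r : ℝ) (v : EuclideanSpace ℂ X) :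
    tensorPow (dyad (r • v)) t x y = (r : ℂ) ^ (2 * t) * tensorPow (dyad v) t x y := by
  simp [tensorPow_dyad_apply, Finset.prod_mul_distrib, Complex.real_smul]
  ring

/-- Real dimension `2|X|` and degree `2t` turn the radial factor into `Γ(|X| + t) / 2`, a factorial.
-/
theorem integral_toSphere_tensorPow [Nonempty X] {t : ℕ} (x y : Fin t → X) :
    (∫ u : Metric.sphere (0 : EuclideanSpace ℂ X) 1, tensorPow (dyad (u : EuclideanSpace ℂ X)) t x y
      ∂(lebesgue X).toSphere) * (((Fintype.card X + t - 1).factorial / 2 : ℝ) : ℂ) =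
      if occurrences x = occurrences y then
        (Real.pi : ℂ) ^ Fintype.card X * ∏ a, ((occurrences x a).factorial : ℂ) else 0 := by
  have hc : 0 < Fintype.card X := Fintype.card_pos
  rw [← integral_gaussian_tensorPow,
    integral_mul_exp_eq_integral_toSphere (lebesgue X) (fun v => tensorPow (dyad v) t x y) (2 * t)
      (fun r v _ => tensorPow_dyad_smul x y r v), finrank_real_euclideanSpace]
  have e : (((2 * Fintype.card X + 2 * t : ℕ) : ℝ) / 2) =
      ((Fintype.card X + t - 1 : ℕ) : ℝ) + 1 := by
    rw [← Nat.cast_succ, Nat.succ_eq_add_one, Nat.sub_add_cancel (by omega)]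
    push_cast
    ring
  rw [e, Real.Gamma_nat_eq_factorial]

theorem toSphere_lebesgue_univ [Nonempty X] :
    ((((lebesgue X).toSphere.real Set.univ : ℝ)) : ℂ) *
      (((Fintype.card X - 1).factorial / 2 : ℝ) : ℂ) = (Real.pi : ℂ) ^ Fintype.card X := by
  -- Degree zero gives the total mass of the sphere, hence the normalization.
  have h := integral_toSphere_tensorPow (X := X) (t := 0) Fin.elim0 Fin.elim0
  simp [tensorPow_dyad_apply, occurrences] at h
  simpa using h

/-- The moments of a Haar random state. -/
theorem haarAverage_apply [Nonempty X] {t : ℕ} (x y : Fin t → X) :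
    haarAverage X t x y = if occurrences x = occurrences y then
      ((Fintype.card X - 1).factorial : ℂ) / ((Fintype.card X + t - 1).factorial : ℂ) *
        ∏ a, ((occurrences x a).factorial : ℂ) else 0 := by
  have h1 := integral_toSphere_tensorPow x y
  have h2 := toSphere_lebesgue_univ (X := X)
  have hpi : (Real.pi : ℂ) ^ Fintype.card X ≠ 0 := pow_ne_zero _ (by exact_mod_cast Real.pi_ne_zero)
  have hm : (((lebesgue X).toSphere.real Set.univ : ℝ) : ℂ) ≠ 0 := by
    intro h0
    rw [h0, zero_mul] at h2
    exact hpi h2.symm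
  have hf : ((Fintype.card X + t - 1).factorial : ℂ) ≠ 0 := by
    exact_mod_cast Nat.factorial_ne_zero _
  have hf' : ((Fintype.card X - 1).factorial : ℂ) ≠ 0 := by
    exact_mod_cast Nat.factorial_ne_zero _
  simp only [haarAverage, Matrix.of_apply, haarState, integral_smul_measure, ENNReal.toReal_inv,
    ← measureReal_def, Complex.real_smul]
  push_cast at h1 h2 ⊢
  split_ifs at h1 ⊢ with hxy
  · rw [← h2] at h1
    field_simp at h1 ⊢
    linear_combination h1
  · have : (∫ u : Metric.sphere (0 : EuclideanSpace ℂ X) 1,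
        tensorPow (dyad (u : EuclideanSpace ℂ X)) t x y ∂(lebesgue X).toSphere) = 0 := by
      rcases mul_eq_zero.1 h1 with h | h
      · exact h
      · exact absurd h (div_ne_zero hf two_ne_zero)
    rw [this, mul_zero]

end Haar

/-! ### The Haar average as a multiple of the symmetric projector. -/

section Symmetric

variable {X : Type} [Fintype X] [DecidableEq X] {t : ℕ}

-- Equal fibre sizes give bijections between the fibres over each letter, which glue to one
-- permutation.
omit [Fintype X] in
theorem occurrences_eq_iff_exists_perm (x y : Fin t → X) :
    occurrences x = occurrences y ↔ ∃ τ : Equiv.Perm (Fin t), x ∘ τ = y := by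
  constructor
  · intro h
    have e : ∀ a, Nonempty ({i // y i = a} ≃ {i // x i = a}) := fun a =>
      Fintype.card_eq.1 (congrFun h a).symm
    have e := fun a => (e a).some
    exact ⟨Equiv.ofFiberEquiv e, funext fun i => Equiv.ofFiberEquiv_map e i⟩
  · rintro ⟨τ, rfl⟩
    funext a
    exact (Fintype.card_congr (τ.subtypeEquiv fun i => Iff.rfl)).symm

/-- When nonempty, this set is a coset of the stabilizer of `x`, a product of symmetric groups on
the fibres. -/
theorem card_perm_comp_eq (x y : Fin t → X) :
    Fintype.card {σ : Equiv.Perm (Fin t) // x ∘ σ = y} =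
      if occurrences x = occurrences y then ∏ a, (occurrences x a).factorial else 0 := by
  split_ifs with h
  · obtain ⟨τ, rfl⟩ := (occurrences_eq_iff_exists_perm x y).1 h
    refine Eq.trans ?_ (DomMulAct.stabilizer_card x)
    refine Fintype.card_congr ((Equiv.mulRight τ⁻¹).subtypeEquiv fun σ => ?_)
    constructor
    · intro hσ
      funext i
      simpa using congrFun hσ (τ⁻¹ i)
    · intro hσ
      funext i
      simpa using congrFun hσ (τ i)
  · rw [Fintype.card_eq_zero_iff]
    exact ⟨fun σ => h ((occurrences_eq_iff_exists_perm x y).2 ⟨σ.1, σ.2⟩)⟩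

theorem factorial_div_factorial_eq {N t : ℕ} (hN : 0 < N) :
    ((N - 1).factorial : ℂ) / ((N + t - 1).factorial : ℂ) =
      ((N + t - 1).choose t : ℂ)⁻¹ * (t.factorial : ℂ)⁻¹ := by
  have h := Nat.choose_mul_factorial_mul_factorial (n := N + t - 1) (k := t) (by omega)
  rw [show N + t - 1 - t = N - 1 by omega] at h
  rw [← h]
  have h1 : ((N - 1).factorial : ℂ) ≠ 0 := by exact_mod_cast Nat.factorial_ne_zero _
  have h2 : (t.factorial : ℂ) ≠ 0 := by exact_mod_cast Nat.factorial_ne_zero _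
  have h3 : ((N + t - 1).choose t : ℂ) ≠ 0 := by
    exact_mod_cast (Nat.choose_pos (by omega)).ne'
  push_cast
  field_simp

theorem haarAverage_apply_eq_card_perm [Nonempty X] (x y : Fin t → X) :
    haarAverage X t x y = ((Fintype.card X + t - 1).choose t : ℂ)⁻¹ *
      ((t.factorial : ℂ)⁻¹ * Fintype.card {σ : Equiv.Perm (Fin t) // x ∘ σ = y}) := by
  rw [haarAverage_apply, card_perm_comp_eq, factorial_div_factorial_eq Fintype.card_pos]
  split_ifs
  · push_cast
    ring
  · simp

/-- The average of a vector over all permutations of the tensor factors. -/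
noncomputable def symmetrize (v : EuclideanSpace ℂ (Fin t → X)) : EuclideanSpace ℂ (Fin t → X) :=
  WithLp.toLp 2 fun x => (t.factorial : ℂ)⁻¹ * ∑ σ : Equiv.Perm (Fin t), v (x ∘ σ)

omit [Fintype X] [DecidableEq X] in
theorem symmetrize_mem_symSubspace (v : EuclideanSpace ℂ (Fin t → X)) :
    symmetrize v ∈ symSubspace X t := by
  intro τ x
  simp only [symmetrize]
  congr 1
  exact Fintype.sum_equiv (Equiv.mulLeft τ) _ _ fun σ => rfl

omit [DecidableEq X] in
theorem inner_symmetrize_of_mem {w : EuclideanSpace ℂ (Fin t → X)} (hw : w ∈ symSubspace X t)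
    (v : EuclideanSpace ℂ (Fin t → X)) : inner ℂ (symmetrize v) w = inner ℂ v w := by
  have h : ∀ σ : Equiv.Perm (Fin t), ∑ x, w x * star (v (x ∘ σ)) = ∑ x, w x * star (v x) := by
    intro σ
    refine Fintype.sum_equiv (Equiv.arrowCongr σ⁻¹ (Equiv.refl X)) _ _ fun x => ?_
    have e : Equiv.arrowCongr σ⁻¹ (Equiv.refl X) x = x ∘ σ := by
      funext i
      simp [Equiv.arrowCongr, Equiv.Perm.inv_def]
    rw [e, hw σ x]
  simp only [EuclideanSpace.inner_eq_star_dotProduct, dotProduct, symmetrize, Pi.star_apply,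
    star_mul', star_sum, Finset.mul_sum]
  rw [Finset.sum_comm]
  have h2 : ∀ σ : Equiv.Perm (Fin t),
      ∑ x, w x * (star ((t.factorial : ℂ)⁻¹) * star (v (x ∘ σ))) =
        (t.factorial : ℂ)⁻¹ * ∑ x, w x * star (v x) := by
    intro σ
    rw [← h σ, Finset.mul_sum]
    refine Finset.sum_congr rfl fun x _ => ?_
    simp
    ring
  rw [Finset.sum_congr rfl fun σ _ => h2 σ, Finset.sum_const, Finset.card_univ,
    Fintype.card_perm, Fintype.card_fin, nsmul_eq_mul, ← mul_assoc, mul_inv_cancel₀, one_mul]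
  exact_mod_cast Nat.factorial_ne_zero _

omit [DecidableEq X] in
theorem starProjection_symSubspace (v : EuclideanSpace ℂ (Fin t → X)) :
    (symSubspace X t).starProjection v = symmetrize v := by
  refine Submodule.eq_starProjection_of_mem_of_inner_eq_zero (symmetrize_mem_symSubspace v)
    fun w hw => ?_
  rw [inner_sub_left, inner_symmetrize_of_mem hw, sub_self]

/-- The Haar average of `|φ⟩⟨φ|^{⊗t}` is the normalized projector onto the symmetric subspace. -/
theorem toEuclideanCLM_haarAverage [Nonempty X] (t : ℕ) :
    Matrix.toEuclideanCLM (𝕜 := ℂ) (haarAverage X t) =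
      (((Fintype.card X + t - 1).choose t : ℂ))⁻¹ • (symSubspace X t).starProjection := by
  ext v x
  rw [smul_apply, starProjection_symSubspace, Matrix.ofLp_toEuclideanCLM,
    PiLp.smul_apply, smul_eq_mul]
  simp only [Matrix.mulVec, dotProduct, haarAverage_apply_eq_card_perm, symmetrize, mul_assoc,
    ← Finset.mul_sum]
  congr 2
  rw [← Finset.sum_fiberwise (s := Finset.univ) (g := fun σ : Equiv.Perm (Fin t) => x ∘ σ)]
  refine Finset.sum_congr rfl fun y _ => ?_
  rw [Finset.sum_congr rfl (g := fun _ => v y) (fun σ hσ => by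
    rw [(Finset.mem_filter.1 hσ).2]), Finset.sum_const, Fintype.card_subtype, nsmul_eq_mul]

end Symmetric

/-! ### Normalization and trace of the Haar average. -/

section HaarTrace

variable {X : Type} [Fintype X] [Nonempty X]

instance isProbabilityMeasure_haarState : IsProbabilityMeasure (haarState X) := by
  have : Nontrivial (EuclideanSpace ℂ X) := inferInstance
  have : NeZero (lebesgue X).toSphere := ⟨Measure.toSphere_ne_zero _⟩
  exact isProbabilityMeasureSMul

omit [Nonempty X] in
theorem trace_tensorPow (A : Matrix X X ℂ) (t : ℕ) : (tensorPow A t).trace = A.trace ^ t := by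
  simp [Matrix.trace, tensorPow, Fintype.sum_pow]

omit [Nonempty X] in
theorem trace_dyad (ψ : EuclideanSpace ℂ X) : (dyad ψ).trace = ((‖ψ‖ ^ 2 : ℝ) : ℂ) := by
  rw [EuclideanSpace.norm_sq_eq]
  simp [Matrix.trace, dyad, Complex.mul_conj, Complex.normSq_eq_norm_sq]

theorem trace_haarAverage (t : ℕ) : (haarAverage X t).trace = 1 := by
  simp only [Matrix.trace, haarAverage, Matrix.diag_apply, Matrix.of_apply]
  rw [← integral_finsetSum]
  · have h : ∀ φ : Metric.sphere (0 : EuclideanSpace ℂ X) 1,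
        ∑ x, tensorPow (dyad (φ : EuclideanSpace ℂ X)) t x x = 1 := by
      intro φ
      have h1 := trace_tensorPow (dyad (φ : EuclideanSpace ℂ X)) t
      rw [trace_dyad, norm_eq_of_mem_sphere φ] at h1
      simpa [Matrix.trace] using h1
    simp [h]
  · intro x _
    refine Continuous.integrable_of_hasCompactSupport ?_ (HasCompactSupport.of_compactSpace _)
    simp only [tensorPow, dyad, Matrix.of_apply]
    fun_prop

end HaarTrace

/-! ### Harmonic functions on `t`-subsets and the Johnson scheme. -/

section Harmonic

variable {X : Type} [Fintype X] [DecidableEq X]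

/-- Functions on the `t`-subsets of `X`, extended by zero, whose sums over the `t`-subsets
containing a given `(t - 1)`-subset vanish. -/
structure IsHarmonic (t : ℕ) (g : Finset X → ℂ) : Prop where
  eq_zero_of_card_ne : ∀ A, A.card ≠ t → g A = 0
  sum_superset : ∀ C : Finset X, C.card + 1 = t → ∑ A, (if C ⊆ A then g A else 0) = 0

variable {t : ℕ} {g : Finset X → ℂ}

/-- Downward induction on `|I|` by double counting: summing over `x ∉ I` the sums for `insert x I`
counts each `t`-set `A ⊇ I` exactly `t - |I|` times. -/
theorem IsHarmonic.sum_superset_of_card_lt (hg : IsHarmonic t g) (k : ℕ) :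
    ∀ I : Finset X, I.card + (k + 1) = t → ∑ A, (if I ⊆ A then g A else 0) = 0 := by
  induction k with
  | zero => exact fun I hI => hg.sum_superset I hI
  | succ k ih =>
    intro I hI
    have h1 : ∑ x ∈ Iᶜ, ∑ A, (if insert x I ⊆ A then g A else 0) = 0 := by
      refine Finset.sum_eq_zero fun x hx => ih _ ?_
      rw [Finset.card_insert_of_notMem (Finset.mem_compl.1 hx)]
      omega
    rw [Finset.sum_comm] at h1
    have h2 : ∀ A : Finset X, ∑ x ∈ Iᶜ, (if insert x I ⊆ A then g A else 0) =
        ((k + 2 : ℕ) : ℂ) * (if I ⊆ A then g A else 0) := by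
      intro A
      by_cases hIA : I ⊆ A
      · by_cases hA : A.card = t
        · have : Finset.filter (fun x => insert x I ⊆ A) Iᶜ = A \ I := by
            ext x
            simp only [Finset.mem_filter, Finset.mem_compl, Finset.insert_subset_iff,
              Finset.mem_sdiff]
            tauto
          rw [← Finset.sum_filter, Finset.sum_const, this, Finset.card_sdiff_of_subset hIA, hA,
            if_pos hIA, nsmul_eq_mul]
          congr 2
          omega
        · simp [hg.eq_zero_of_card_ne A hA]
      · rw [if_neg hIA, mul_zero]
        exact Finset.sum_eq_zero fun x _ =>
          if_neg fun h => hIA ((Finset.subset_insert x I).trans h)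
    rw [Finset.sum_congr rfl fun A _ => h2 A, ← Finset.mul_sum] at h1
    rcases mul_eq_zero.1 h1 with h | h
    · exact absurd h (Nat.cast_ne_zero.2 (Nat.succ_ne_zero _))
    · exact h

/-- The binomial counts the `i`-subsets `I` of `A ∩ B`. After exchanging sums, each `I` with fewer
than `t` elements contributes zero by harmonicity, and only `I = B` can have `t`. -/
theorem IsHarmonic.sum_mul_choose (hg : IsHarmonic t g) {B : Finset X} (hB : B.card ≤ t) (i : ℕ) :
    ∑ A, g A * ((A ∩ B).card.choose i : ℂ) = if i = t then g B else 0 := by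
  have h1 : ∀ A : Finset X, g A * ((A ∩ B).card.choose i : ℂ) =
      ∑ I ∈ Finset.powersetCard i B, if I ⊆ A then g A else 0 := by
    intro A
    rw [← Finset.sum_filter, Finset.sum_const, nsmul_eq_mul, mul_comm, ← Finset.card_powersetCard]
    congr 3
    ext I
    simp only [Finset.mem_powersetCard, Finset.mem_filter, Finset.subset_inter_iff]
    tauto
  rw [Finset.sum_congr rfl fun A _ => h1 A, Finset.sum_comm]
  split_ifs with hi
  · subst hi
    rcases hB.eq_or_lt with hB | hB
    · rw [← hB, Finset.powersetCard_self, Finset.sum_singleton, Finset.sum_eq_single B]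
      · rw [if_pos subset_rfl]
      · intro A _ hA
        split_ifs with h
        · refine hg.eq_zero_of_card_ne A fun h' => hA ?_
          exact (Finset.eq_of_subset_of_card_le h (by omega)).symm
        · rfl
      · simp
    · rw [Finset.powersetCard_eq_empty.2 hB, Finset.sum_empty, hg.eq_zero_of_card_ne B hB.ne]
  · refine Finset.sum_eq_zero fun I hI => ?_
    obtain ⟨hIB, hIc⟩ := Finset.mem_powersetCard.1 hI
    have := Finset.card_le_card hIB
    exact hg.sum_superset_of_card_lt (t - i - 1) I (by omega)

/-- A harmonic function is an eigenvector of the Johnson scheme operator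
`C(N - |A ∪ B|, c)`, also when it is tested against smaller sets `B`. -/
theorem IsHarmonic.sum_mul_choose_card_union (hg : IsHarmonic t g) {B : Finset X}
    (hB : B.card ≤ t) (ht : 2 * t ≤ Fintype.card X) {c : ℕ} (hc : t ≤ c) :
    ∑ A, g A * ((Fintype.card X - (A ∪ B).card).choose c : ℂ) =
      ((Fintype.card X - 2 * t).choose (c - t) : ℂ) * g B := by
  have h1 : ∀ A : Finset X, g A * ((Fintype.card X - (A ∪ B).card).choose c : ℂ) =
      ∑ ij ∈ Finset.HasAntidiagonal.antidiagonal c, ((Fintype.card X - t - B.card).choose ij.1 : ℂ) *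
        (g A * ((A ∩ B).card.choose ij.2 : ℂ)) := by
    intro A
    by_cases hA : A.card = t
    -- Vandermonde's identity now expands the binomial in the `(A ∩ B).card.choose j`, of which only
    -- `j = t` survives the sum against `g`.
    · have e : Fintype.card X - (A ∪ B).card = (Fintype.card X - t - B.card) + (A ∩ B).card := by
        have := Finset.card_union_add_card_inter A B
        have := Finset.card_le_univ (A ∪ B)
        omega
      rw [e, Nat.add_choose_eq]
      push_cast
      rw [Finset.mul_sum]
      exact Finset.sum_congr rfl fun ij _ => by ring
    · simp [hg.eq_zero_of_card_ne A hA]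
  rw [Finset.sum_congr rfl fun A _ => h1 A, Finset.sum_comm]
  simp only [← Finset.mul_sum, hg.sum_mul_choose hB]
  rw [Finset.sum_eq_single (c - t, t)]
  · rw [if_pos rfl]
    by_cases hBt : B.card = t
    · rw [hBt, show Fintype.card X - 2 * t = Fintype.card X - t - t by omega]
    · rw [hg.eq_zero_of_card_ne B hBt, mul_zero, mul_zero]
  · rintro ⟨i, j⟩ hij hne
    rw [Finset.HasAntidiagonal.mem_antidiagonal] at hij
    rw [if_neg, mul_zero]
    rintro rfl
    exact hne (Prod.ext (by simp only at hij ⊢; omega) rfl)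
  · intro h
    exact absurd (Finset.HasAntidiagonal.mem_antidiagonal.2 (Nat.sub_add_cancel hc)) h

/-- Complementation turns supersets of `U` into subsets of `Uᶜ`. In this form the count is correctly
zero for `|U| > m`, and Vandermonde applies to it. -/
theorem card_filter_subset_powersetCard {m : ℕ} (hm : m ≤ Fintype.card X) (U : Finset X) :
    ((Finset.powersetCard m (Finset.univ : Finset X)).filter (U ⊆ ·)).card =
      (Fintype.card X - U.card).choose (Fintype.card X - m) := by
  rw [← Finset.card_compl, ← Finset.card_powersetCard]
  refine Finset.card_bij' (fun S _ => Sᶜ) (fun S _ => Sᶜ) ?_ ?_ ?_ ?_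
  · intro S hS
    simp only [Finset.mem_filter, Finset.mem_powersetCard] at hS ⊢
    exact ⟨Finset.compl_subset_compl.2 hS.2, by rw [Finset.card_compl, hS.1.2]⟩
  · intro S hS
    simp only [Finset.mem_filter, Finset.mem_powersetCard] at hS ⊢
    refine ⟨⟨Finset.subset_univ _, ?_⟩, ?_⟩
    · rw [Finset.card_compl, hS.2]
      omega
    · rw [Finset.subset_compl_comm]
      exact hS.1
  · simp
  · simp

/-- Such tuples are the bijections `Fin t ≃ A`. -/
theorem card_tuples_image_eq {A : Finset X} (hA : A.card = t) :
    Fintype.card {y : Fin t → X // Finset.univ.image y = A} = t.factorial := by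
  have hcard : Fintype.card (Fin t) = Fintype.card A := by simp [hA]
  rw [← Fintype.card_fin t, ← Fintype.card_equiv (Fintype.equivOfCardEq hcard), Fintype.card_fin]
  symm
  refine Fintype.card_of_bijective (f := fun e : Fin t ≃ A =>
    (⟨fun i => (e i : X), ?_⟩ : {y : Fin t → X // Finset.univ.image y = A})) ⟨?_, ?_⟩
  · ext a
    simp only [Finset.mem_image, Finset.mem_univ, true_and]
    constructor
    · rintro ⟨i, rfl⟩
      exact (e i).2
    · intro ha
      exact ⟨e.symm ⟨a, ha⟩, by simp⟩
  · intro e e' h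
    ext i
    exact congrFun (congrArg Subtype.val h) i
  · rintro ⟨y, hy⟩
    have hmem : ∀ i, y i ∈ A := fun i => hy ▸ Finset.mem_image_of_mem y (Finset.mem_univ i)
    have hsurj : Function.Surjective fun i => (⟨y i, hmem i⟩ : A) := by
      rintro ⟨a, ha⟩
      rw [← hy] at ha
      obtain ⟨i, -, hi⟩ := Finset.mem_image.1 ha
      exact ⟨i, Subtype.ext hi⟩
    exact ⟨Equiv.ofBijective _ ((Fintype.bijective_iff_surjective_and_card _).2 ⟨hsurj, hcard⟩),
      rfl⟩

theorem sum_tuples_image {F : Finset X → ℂ} (hF : ∀ A, A.card ≠ t → F A = 0) :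
    ∑ y : Fin t → X, F (Finset.univ.image y) = (t.factorial : ℂ) * ∑ A, F A := by
  rw [← Finset.sum_fiberwise (s := Finset.univ) (g := fun y : Fin t → X => Finset.univ.image y),
    Finset.mul_sum]
  refine Finset.sum_congr rfl fun A _ => ?_
  rw [Finset.sum_congr rfl (g := fun _ => F A) (fun y hy => by
    rw [(Finset.mem_filter.1 hy).2]), Finset.sum_const, ← Fintype.card_subtype, nsmul_eq_mul]
  by_cases hA : A.card = t
  · rw [card_tuples_image_eq hA]
  · rw [hF A hA, mul_zero, mul_zero]

/-- The operator that sums a function on `t`-subsets over the supersets of a `(t - 1)`-subset. -/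
def superSum (X : Type) [Fintype X] [DecidableEq X] (t : ℕ) :
    ({A : Finset X // A.card = t} → ℂ) →ₗ[ℂ] ({C : Finset X // C.card + 1 = t} → ℂ) where
  toFun g C := ∑ A, if C.1 ⊆ A.1 then g A else 0
  map_add' g h := by
    funext C
    rw [Pi.add_apply, ← Finset.sum_add_distrib]
    exact Finset.sum_congr rfl fun A _ => by split_ifs <;> simp
  map_smul' c g := by
    funext C
    simp only [Pi.smul_apply, smul_eq_mul, RingHom.id_apply, Finset.mul_sum, mul_ite, mul_zero]

/-- The extension by zero of a function on `t`-subsets. -/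
def extendZero (g : {A : Finset X // A.card = t} → ℂ) (A : Finset X) : ℂ :=
  if h : A.card = t then g ⟨A, h⟩ else 0

omit [DecidableEq X] in
theorem sum_extendZero (g : {A : Finset X // A.card = t} → ℂ) (p : Finset X → Prop)
    [DecidablePred p] :
    ∑ A, (if p A then extendZero g A else 0) =
      ∑ A : {A : Finset X // A.card = t}, if p A.1 then g A else 0 := by
  have h := Finset.sum_subtype (F := inferInstance) (Finset.univ.filter fun A : Finset X => A.card = t)
    (p := fun A => A.card = t) (fun A => by simp) (fun A => if p A then extendZero g A else 0)
  have h2 : ∑ A, (if p A then extendZero g A else 0) =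
      ∑ A ∈ Finset.univ.filter (fun A : Finset X => A.card = t),
        if p A then extendZero g A else 0 := by
    rw [Finset.sum_filter]
    refine Finset.sum_congr rfl fun A _ => ?_
    by_cases hA : A.card = t <;> simp [extendZero, hA]
  rw [h2, h]
  exact Finset.sum_congr rfl fun A _ => by rw [extendZero, dif_pos A.2]

theorem isHarmonic_extendZero {g : {A : Finset X // A.card = t} → ℂ}
    (hg : g ∈ LinearMap.ker (superSum X t)) : IsHarmonic t (extendZero g) where
  eq_zero_of_card_ne A hA := dif_neg hA
  sum_superset C hC := by
    rw [sum_extendZero g (C ⊆ ·)]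
    exact congrFun (LinearMap.mem_ker.1 hg) ⟨C, hC⟩

/-- The symmetric vector whose entry at a tuple `x` with distinct entries is the value of the
function at the set of these entries. -/
def tupleLift (X : Type) [Fintype X] [DecidableEq X] (t : ℕ) :
    ({A : Finset X // A.card = t} → ℂ) →ₗ[ℂ] EuclideanSpace ℂ (Fin t → X) where
  toFun g := WithLp.toLp 2 fun x => extendZero g (Finset.univ.image x)
  map_add' g h := by
    ext x
    by_cases hx : (Finset.univ.image x).card = t <;> simp [extendZero, hx]
  map_smul' c g := by
    ext x
    by_cases hx : (Finset.univ.image x).card = t <;> simp [extendZero, hx]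

theorem tupleLift_injective : Function.Injective (tupleLift X t) := by
  intro g h hgh
  funext A
  have : 0 < Fintype.card {y : Fin t → X // Finset.univ.image y = A.1} := by
    rw [card_tuples_image_eq A.2]
    exact Nat.factorial_pos t
  obtain ⟨y, hy⟩ := Fintype.card_pos_iff.1 this
  have h1 := congrArg (fun v : EuclideanSpace ℂ (Fin t → X) => v y) hgh
  simpa [tupleLift, extendZero, hy, A.2] using h1

/-- The top harmonic subspace, inside the `t`-fold tensor power. -/
def harmonicSubspace (X : Type) [Fintype X] [DecidableEq X] (t : ℕ) :
    Submodule ℂ (EuclideanSpace ℂ (Fin t → X)) :=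
  (LinearMap.ker (superSum X t)).map (tupleLift X t)

theorem exists_isHarmonic_of_mem_harmonicSubspace {v : EuclideanSpace ℂ (Fin t → X)}
    (hv : v ∈ harmonicSubspace X t) :
    ∃ g : Finset X → ℂ, IsHarmonic t g ∧ ∀ x, v x = g (Finset.univ.image x) := by
  obtain ⟨g, hg, rfl⟩ := hv
  exact ⟨extendZero g, isHarmonic_extendZero hg, fun x => rfl⟩

theorem harmonicSubspace_le_symSubspace : harmonicSubspace X t ≤ symSubspace X t := by
  intro v hv σ x
  obtain ⟨g, -, h⟩ := exists_isHarmonic_of_mem_harmonicSubspace hv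
  rw [h, h]
  congr 1
  ext a
  simp only [Finset.mem_image, Finset.mem_univ, true_and, Function.comp_apply]
  exact ⟨fun ⟨i, hi⟩ => ⟨σ i, hi⟩, fun ⟨i, hi⟩ => ⟨σ.symm i, by simpa using hi⟩⟩

/-- Rank-nullity for `superSum`. Indexing by `C.card + 1 = t` rather than `t - 1` makes the target
zero when `t = 0`. -/
theorem choose_le_finrank_harmonicSubspace (X : Type) [Fintype X] [DecidableEq X] (t : ℕ) :
    (Fintype.card X).choose t ≤ Module.finrank ℂ (harmonicSubspace X t) +
      Fintype.card {C : Finset X // C.card + 1 = t} := by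
  have h1 : Module.finrank ℂ (harmonicSubspace X t) =
      Module.finrank ℂ (LinearMap.ker (superSum X t)) :=
    (Submodule.equivMapOfInjective _ tupleLift_injective _).finrank_eq.symm
  have h2 := LinearMap.finrank_range_add_finrank_ker (superSum X t)
  have h3 := Submodule.finrank_le (LinearMap.range (superSum X t))
  rw [Module.finrank_fintype_fun_eq_card] at h2 h3
  rw [Fintype.card_finset_len] at h2
  omega

theorem card_subtype_card_add_one_mul (X : Type) [Fintype X] [DecidableEq X] {t : ℕ} :
    Fintype.card {C : Finset X // C.card + 1 = t} * (Fintype.card X + 1 - t) =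
      t * (Fintype.card X).choose t := by
  cases t with
  | zero => simp
  | succ s =>
    have : Fintype.card {C : Finset X // C.card + 1 = s + 1} = (Fintype.card X).choose s := by
      rw [← Fintype.card_finset_len]
      exact Fintype.card_congr (Equiv.subtypeEquivRight fun C => by omega)
    rw [this, Nat.add_sub_add_right, mul_comm (s + 1), Nat.choose_succ_right_eq]

end Harmonic

/-! ### Spectrum of the subset state average on the harmonic space. -/

section SubsetAverage

open scoped ComplexOrder

variable {X : Type} [Fintype X] [DecidableEq X] {t m : ℕ}

omit [Fintype X] in
theorem tensorPow_dyad_subsetState (S : Finset X) (x y : Fin t → X) :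
    tensorPow (dyad (subsetState S)) t x y =
      if Finset.univ.image x ∪ Finset.univ.image y ⊆ S then ((S.card : ℂ)⁻¹) ^ t else 0 := by
  have hsq : (((Real.sqrt (S.card : ℝ))⁻¹ : ℝ) : ℂ) * (((Real.sqrt (S.card : ℝ))⁻¹ : ℝ) : ℂ) =
      (S.card : ℂ)⁻¹ := by
    rw [← Complex.ofReal_mul, ← mul_inv, Real.mul_self_sqrt (Nat.cast_nonneg _)]
    simp
  have h : ∀ i, dyad (subsetState S) (x i) (y i) =
      if x i ∈ S ∧ y i ∈ S then (S.card : ℂ)⁻¹ else 0 := by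
    intro i
    rw [← hsq]
    by_cases hx : x i ∈ S <;> by_cases hy : y i ∈ S <;> simp [dyad, subsetState, hx, hy]
  simp only [tensorPow, Matrix.of_apply, h]
  split_ifs with hS
  · rw [Finset.prod_congr rfl fun i _ => if_pos
      ⟨hS (Finset.mem_union_left _ (Finset.mem_image_of_mem x (Finset.mem_univ i))),
        hS (Finset.mem_union_right _ (Finset.mem_image_of_mem y (Finset.mem_univ i)))⟩]
    simp
  · have : ∃ i, ¬(x i ∈ S ∧ y i ∈ S) := by
      by_contra! hall
      refine hS fun a ha => ?_
      simp only [Finset.mem_union, Finset.mem_image, Finset.mem_univ, true_and] at ha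
      rcases ha with ⟨i, rfl⟩ | ⟨i, rfl⟩
      · exact (hall i).1
      · exact (hall i).2
    obtain ⟨i, hi⟩ := this
    exact Finset.prod_eq_zero (Finset.mem_univ i) (if_neg hi)

theorem subsetAverage_apply (hm : m ≤ Fintype.card X) (x y : Fin t → X) :
    subsetAverage X m t x y = ((Fintype.card X).choose m : ℂ)⁻¹ * ((m : ℂ)⁻¹) ^ t *
      ((Fintype.card X - (Finset.univ.image x ∪ Finset.univ.image y).card).choose
        (Fintype.card X - m) : ℂ) := by
  rw [subsetAverage, Finset.card_powersetCard, Finset.card_univ, Matrix.smul_apply,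
    Matrix.sum_apply, smul_eq_mul, mul_assoc]
  congr 1
  rw [← card_filter_subset_powersetCard hm, mul_comm, ← nsmul_eq_mul, ← Finset.sum_const,
    Finset.sum_filter]
  refine Finset.sum_congr rfl fun S hS => ?_
  rw [tensorPow_dyad_subsetState, (Finset.mem_powersetCard.1 hS).2]

omit [DecidableEq X] in
theorem posSemidef_tensorPow_dyad (ψ : EuclideanSpace ℂ X) :
    (tensorPow (dyad ψ) t).PosSemidef := by
  have h : tensorPow (dyad ψ) t =
      Matrix.vecMulVec (fun x : Fin t → X => ∏ i, ψ (x i)) (star fun x => ∏ i, ψ (x i)) := by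
    ext x y
    rw [tensorPow_dyad_apply]
    simp [Matrix.vecMulVec_apply]
  rw [h]
  exact Matrix.posSemidef_vecMulVec_self_star _

theorem posSemidef_subsetAverage : (subsetAverage X m t).PosSemidef := by
  refine Matrix.PosSemidef.smul
    (Matrix.posSemidef_sum _ fun S _ => posSemidef_tensorPow_dyad _) ?_
  exact inv_nonneg.2 (Nat.cast_nonneg _)

theorem trace_subsetAverage (hm : 0 < m) (hmN : m ≤ Fintype.card X) :
    (subsetAverage X m t).trace = 1 := by
  rw [subsetAverage, Matrix.trace_smul, Matrix.trace_sum]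
  have h : ∀ S ∈ Finset.powersetCard m (Finset.univ : Finset X),
      (tensorPow (dyad (subsetState S)) t).trace = 1 := by
    intro S hS
    have hc : S.card = m := (Finset.mem_powersetCard.1 hS).2
    have hm' : (m : ℝ) ≠ 0 := Nat.cast_ne_zero.2 hm.ne'
    have hnorm : ‖subsetState S‖ ^ 2 = 1 := by
      rw [EuclideanSpace.norm_sq_eq]
      have : ∀ x, ‖(subsetState S) x‖ ^ 2 = if x ∈ S then (m : ℝ)⁻¹ else 0 := by
        intro x
        by_cases hx : x ∈ S <;> simp [subsetState, hx, hc]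
      rw [Finset.sum_congr rfl fun x _ => this x, Finset.sum_ite_mem, Finset.univ_inter,
        Finset.sum_const, hc, nsmul_eq_mul, mul_inv_cancel₀ hm']
    rw [trace_tensorPow, trace_dyad, hnorm]
    simp
  rw [Finset.sum_congr rfl h, Finset.sum_const, Finset.card_powersetCard, Finset.card_univ,
    nsmul_eq_mul, mul_one, smul_eq_mul, inv_mul_cancel₀]
  exact Nat.cast_ne_zero.2 (Nat.choose_pos hmN).ne'

/-- The eigenvalue of the subset state average on the top harmonic subspace. -/
noncomputable def harmonicEigenvalue (N m t : ℕ) : ℝ :=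
  (N.choose m : ℝ)⁻¹ * ((m : ℝ)⁻¹) ^ t * (t.factorial * (N - 2 * t).choose (N - m - t))

/-- Each `t`-set comes from `t!` tuples, so the matrix acts as `t!` times the Johnson operator. Rows
`x` with repeated entries correspond to sets `B` with `|B| < t`, where both sides must vanish; hence
the eigenvalue identity is needed for smaller `B` too. -/
theorem subsetAverage_apply_of_mem_harmonicSubspace (hmN : m ≤ Fintype.card X)
    (ht : 2 * t ≤ Fintype.card X) (htm : t ≤ Fintype.card X - m)
    {v : EuclideanSpace ℂ (Fin t → X)} (hv : v ∈ harmonicSubspace X t) :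
    Matrix.toEuclideanCLM (𝕜 := ℂ) (subsetAverage X m t) v =
      (harmonicEigenvalue (Fintype.card X) m t : ℂ) • v := by
  obtain ⟨g, hg, hvg⟩ := exists_isHarmonic_of_mem_harmonicSubspace hv
  ext x
  have hB : (Finset.univ.image x).card ≤ t := by
    simpa using Finset.card_image_le (s := Finset.univ) (f := x)
  have h := hg.sum_mul_choose_card_union hB ht htm
  have h2 := sum_tuples_image (t := t) (F := fun A => g A * ((Fintype.card X -
    (A ∪ Finset.univ.image x).card).choose (Fintype.card X - m) : ℂ)) fun A hA => by
      rw [hg.eq_zero_of_card_ne A hA, zero_mul]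
  rw [h] at h2
  rw [Matrix.ofLp_toEuclideanCLM, PiLp.smul_apply, smul_eq_mul, hvg x]
  simp only [Matrix.mulVec, dotProduct, subsetAverage_apply hmN, hvg]
  rw [Finset.sum_congr rfl (g := fun y => ((Fintype.card X).choose m : ℂ)⁻¹ * ((m : ℂ)⁻¹) ^ t *
    (g (Finset.univ.image y) * ((Fintype.card X -
      (Finset.univ.image y ∪ Finset.univ.image x).card).choose (Fintype.card X - m) : ℂ)))
    (fun y _ => by rw [Finset.union_comm]; ring), ← Finset.mul_sum, h2, harmonicEigenvalue]
  push_cast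
  ring

theorem isHermitian_haarAverage [Nonempty X] : (haarAverage X t).IsHermitian := by
  ext x y
  rw [Matrix.conjTranspose_apply, haarAverage_apply, haarAverage_apply]
  by_cases h : occurrences x = occurrences y
  · rw [if_pos h, if_pos h.symm, h]
    simp
  · rw [if_neg h, if_neg fun h' => h h'.symm, star_zero]

/-- The Haar average is a multiple of the projector onto a larger space, and projecting further to
`V` cannot increase norms. -/
theorem le_re_inner_haarAverage [Nonempty X] {V : Submodule ℂ (EuclideanSpace ℂ (Fin t → X))}
    (hV : V ≤ symSubspace X t) {μ : ℝ}
    (hμ : μ ≤ (((Fintype.card X + t - 1).choose t : ℝ))⁻¹)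
    (w : EuclideanSpace ℂ (Fin t → X)) :
    μ * ‖V.starProjection w‖ ^ 2 ≤
      (inner ℂ w (Matrix.toEuclideanCLM (𝕜 := ℂ) (haarAverage X t) w)).re := by
  have h1 : V.starProjection w = V.starProjection ((symSubspace X t).starProjection w) :=
    (congrArg (fun T => T w) (Submodule.starProjection_comp_starProjection_of_le hV)).symm
  have h2 : ‖V.starProjection w‖ ≤ ‖(symSubspace X t).starProjection w‖ := by
    rw [h1]
    exact Submodule.norm_starProjection_apply_le V _
  have hP : (inner ℂ w ((symSubspace X t).starProjection w)).re =
      ‖(symSubspace X t).starProjection w‖ ^ 2 := by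
    have := Submodule.re_inner_starProjection_eq_normSq (symSubspace X t) w
    rw [← inner_conj_symm, Complex.conj_re]
    simpa using this
  have hcast : (((Fintype.card X + t - 1).choose t : ℂ))⁻¹ =
      (((((Fintype.card X + t - 1).choose t : ℝ))⁻¹ : ℝ) : ℂ) := by push_cast; rfl
  rw [toEuclideanCLM_haarAverage, smul_apply, inner_smul_right, hcast,
    Complex.re_ofReal_mul, hP]
  have hc : (0 : ℝ) ≤ (((Fintype.card X + t - 1).choose t : ℝ))⁻¹ := by positivity
  calc _ ≤ (((Fintype.card X + t - 1).choose t : ℝ))⁻¹ * ‖V.starProjection w‖ ^ 2 := by gcongr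
    _ ≤ _ := by gcongr

/-- Both averages dominate a multiple of the projector onto the top harmonic subspace. -/
theorem traceDistance_subsetAverage_haarAverage_le [Nonempty X] (hm : 0 < m)
    (hmN : m ≤ Fintype.card X) (ht : 2 * t ≤ Fintype.card X) (htm : t ≤ Fintype.card X - m) :
    traceDistance (subsetAverage X m t) (haarAverage X t) ≤
      1 - min (harmonicEigenvalue (Fintype.card X) m t)
        (((Fintype.card X + t - 1).choose t : ℝ))⁻¹ *
        Module.finrank ℂ (harmonicSubspace X t) := by
  have h := traceNorm_sub_le posSemidef_subsetAverage.1 isHermitian_haarAverage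
    (harmonicSubspace X t) (min (harmonicEigenvalue (Fintype.card X) m t)
        (((Fintype.card X + t - 1).choose t : ℝ))⁻¹)
    (le_re_inner_of_eigenspace posSemidef_subsetAverage _ _ _ (min_le_left _ _) fun v hv =>
      subsetAverage_apply_of_mem_harmonicSubspace hmN ht htm hv)
    (le_re_inner_haarAverage harmonicSubspace_le_symSubspace (min_le_right _ _))
  rw [trace_subsetAverage hm hmN, trace_haarAverage, Complex.one_re] at h
  rw [traceDistance]
  linarith

end SubsetAverage

/-! ### Elementary estimates for binomial ratios. -/

section Estimates

/-- The falling factorial is at least `(a - t) ^ t`; Bernoulli's inequality applies to `(a - t) / b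
= 1 - (b - a + t) / b`. -/
theorem one_sub_le_descFactorial_div {a b t : ℕ} {D : ℝ} (hta : t ≤ a) (hb : 0 < b)
    (hD : 0 < D) (hDb : D ≤ (b : ℝ) ^ t) :
    1 - t * (((b : ℝ) - a + t) / b) ≤ (a.descFactorial t : ℝ) / D := by
  have hb' : (0 : ℝ) < b := Nat.cast_pos.2 hb
  have hta' : (t : ℝ) ≤ a := Nat.cast_le.2 hta
  have h1 : ((a : ℝ) - t) ^ t ≤ (a.descFactorial t : ℝ) := by
    rw [← Nat.cast_sub hta]
    exact_mod_cast (Nat.pow_le_pow_left (by omega) t).trans (Nat.pow_sub_le_descFactorial a t)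
  have h2 := one_add_mul_le_pow (a := -(((b : ℝ) - a + t) / b)) (by
    have : ((b : ℝ) - a + t) / b ≤ 1 := by
      rw [div_le_one hb']
      linarith
    linarith) t
  have h3 : 1 + -(((b : ℝ) - a + t) / b) = ((a : ℝ) - t) / b := by
    field_simp
    ring
  rw [h3, div_pow] at h2
  calc 1 - t * (((b : ℝ) - a + t) / b) = 1 + t * -(((b : ℝ) - a + t) / b) := by ring
    _ ≤ ((a : ℝ) - t) ^ t / (b : ℝ) ^ t := h2
    _ ≤ (a.descFactorial t : ℝ) / (b : ℝ) ^ t := by gcongr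
    _ ≤ _ := by gcongr

theorem one_sub_add_le_mul {u r α β : ℝ} (hu : 1 - α ≤ u) (hr : 1 - β ≤ r) (hr0 : 0 ≤ r)
    (hr1 : r ≤ 1) (hα : 0 ≤ α) : 1 - (α + β) ≤ u * r := by
  nlinarith [mul_le_mul_of_nonneg_right hu hr0, mul_le_mul_of_nonneg_left hr1 hα]

/-- This writes the eigenvalue times the leading dimension term as two ratios, each close to 1; it
follows from two uses of `Nat.choose_mul`. -/
theorem harmonicEigenvalue_mul_choose {N m t : ℕ} (htm : t ≤ m) (hmN : m ≤ N)
    (ht : t ≤ N - m) :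
    harmonicEigenvalue N m t * N.choose t =
      (((N - m).descFactorial t : ℝ) / ((N - t).descFactorial t : ℝ)) *
        ((m.descFactorial t : ℝ) / (m : ℝ) ^ t) := by
  have h1 := Nat.choose_mul (n := N) (k := m) (s := t) htm
  have h2 := Nat.choose_mul (n := N - t) (k := N - m) (s := t) ht
  have h3 : (N - t).choose (m - t) = (N - t).choose (N - m) := by
    rw [← Nat.choose_symm (by omega)]
    congr 1
    omega
  rw [h3] at h1
  rw [show N - t - t = N - 2 * t by omega] at h2
  have h1' : (N.choose m : ℝ) * m.choose t = N.choose t * (N - t).choose (N - m) := by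
    exact_mod_cast h1
  have h2' : ((N - t).choose (N - m) : ℝ) * (N - m).choose t =
      (N - t).choose t * (N - 2 * t).choose (N - m - t) := by exact_mod_cast h2
  have p1 : (N.choose m : ℝ) ≠ 0 := Nat.cast_ne_zero.2 (Nat.choose_pos hmN).ne'
  have p2 : ((N - t).choose t : ℝ) ≠ 0 := Nat.cast_ne_zero.2 (Nat.choose_pos (by omega)).ne'
  have p3 : (t.factorial : ℝ) ≠ 0 := Nat.cast_ne_zero.2 (Nat.factorial_ne_zero _)
  rw [harmonicEigenvalue, Nat.descFactorial_eq_factorial_mul_choose,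
    Nat.descFactorial_eq_factorial_mul_choose, Nat.descFactorial_eq_factorial_mul_choose]
  push_cast
  have h0 : (m : ℝ) ^ t ≠ 0 := by
    rcases Nat.eq_zero_or_pos m with hm | hm
    · rw [show t = 0 by omega, pow_zero]
      exact one_ne_zero
    · exact pow_ne_zero _ (Nat.cast_ne_zero.2 hm.ne')
  rw [mul_div_mul_left _ _ p3, inv_pow, div_mul_div_comm, eq_div_iff]
  · field_simp
    linear_combination (-(N.choose t : ℝ)) * h2' - ((N - m).choose t : ℝ) * h1'
  · exact mul_ne_zero p2 h0

theorem one_sub_le_min_mul {N m t d c : ℕ} (hm : 0 < m) (htm : t ≤ m) (hmN : 4 * m ≤ N)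
    (hd : N.choose t ≤ d + c) (hc : c * (N + 1 - t) = t * N.choose t) :
    1 - (4 * ((t : ℝ) * m / N) + 2 * ((t : ℝ) ^ 2 / m)) ≤
      min (harmonicEigenvalue N m t) (((N + t - 1).choose t : ℝ))⁻¹ * d := by
  have hmR : (1 : ℝ) ≤ m := by exact_mod_cast hm
  have htR : (0 : ℝ) ≤ t := Nat.cast_nonneg t
  have htmR : (t : ℝ) ≤ m := by exact_mod_cast htm
  have hmNR : 4 * (m : ℝ) ≤ N := by exact_mod_cast hmN
  have hNR : (0 : ℝ) < N := by linarith
  have hpos : (0 : ℝ) < (N : ℝ) + 1 - t := by linarith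
  -- Since `C(N,t-1) = C(N,t) · t / (N + 1 - t)`, this is the fraction of `C(N,t)` left after
  -- subtracting `C(N,t-1)`.
  set r : ℝ := 1 - t / ((N : ℝ) + 1 - t) with hr
  have hr1 : r ≤ 1 := by
    have : 0 ≤ t / ((N : ℝ) + 1 - t) := by positivity
    linarith
  have hr0 : 0 ≤ r := by
    have : t / ((N : ℝ) + 1 - t) ≤ 1 := by
      rw [div_le_one hpos]
      linarith
    linarith
  have hdr : (N.choose t : ℝ) * r ≤ d := by
    have hc' : (c : ℝ) * ((N : ℝ) + 1 - t) = t * N.choose t := by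
      have := congrArg (Nat.cast : ℕ → ℝ) hc
      rw [Nat.cast_mul, Nat.cast_mul, Nat.cast_sub (by omega)] at this
      push_cast at this
      exact this
    have hd' : (N.choose t : ℝ) ≤ d + c := by exact_mod_cast hd
    have : (N.choose t : ℝ) * r = N.choose t - c := by
      rw [hr, mul_sub, mul_one, mul_div_assoc', mul_comm _ (t : ℝ), ← hc',
        mul_div_cancel_right₀ _ hpos.ne']
    linarith
  have hβ : t / ((N : ℝ) + 1 - t) ≤ 2 * ((t : ℝ) * m / N) := by
    rw [mul_div_assoc', div_le_div_iff₀ hpos hNR]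
    nlinarith [mul_nonneg htR hNR.le, mul_nonneg htR (sub_nonneg.2 hmR),
      mul_nonneg (mul_nonneg htR (sub_nonneg.2 hmR)) hpos.le]
  have hsq : (0 : ℝ) ≤ (t : ℝ) ^ 2 / m := by positivity
  have htmN : (0 : ℝ) ≤ (t : ℝ) * m / N := by positivity
  -- The factor `r` loses at most `2tm/N`. The eigenvalue branch loses a further `2tm/N + t²/m`, the
  -- Haar branch a further `2t²/m`; both fit the constants 4 and 2.
  rcases min_choice (harmonicEigenvalue N m t) (((N + t - 1).choose t : ℝ))⁻¹ with hmin | hmin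
  · rw [hmin]
    have hlam : 0 ≤ harmonicEigenvalue N m t := by
      unfold harmonicEigenvalue
      positivity
    refine le_trans ?_ (mul_le_mul_of_nonneg_left hdr hlam)
    rw [← mul_assoc, harmonicEigenvalue_mul_choose htm (by omega) (by omega)]
    have hp := one_sub_le_descFactorial_div (a := m) (b := m) (t := t) (D := (m : ℝ) ^ t) htm hm
      (by positivity) le_rfl
    have hq := one_sub_le_descFactorial_div (a := N - m) (b := N - t) (t := t)
      (D := ((N - t).descFactorial t : ℝ)) (by omega) (by omega)
      (Nat.cast_pos.2 (Nat.descFactorial_pos.2 (by omega)))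
      (by exact_mod_cast Nat.descFactorial_le_pow _ _)
    rw [Nat.cast_sub (by omega), Nat.cast_sub (by omega)] at hq
    have hp1 : (m.descFactorial t : ℝ) / (m : ℝ) ^ t ≤ 1 :=
      div_le_one_of_le₀ (by exact_mod_cast Nat.descFactorial_le_pow _ _) (by positivity)
    have hNt : (0 : ℝ) < (N : ℝ) - t := by linarith
    have hα : (t : ℝ) * (((N : ℝ) - t - (N - m) + t) / (N - t)) ≤ 2 * ((t : ℝ) * m / N) := by
      rw [show (N : ℝ) - t - (N - m) + t = m by ring, mul_div_assoc', mul_div_assoc',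
        div_le_div_iff₀ hNt hNR]
      nlinarith [mul_nonneg (mul_nonneg htR (by linarith : (0 : ℝ) ≤ m))
        (by linarith : (0 : ℝ) ≤ N - 2 * t)]
    have hp' : (t : ℝ) * (((m : ℝ) - m + t) / m) = (t : ℝ) ^ 2 / m := by ring
    rw [hp'] at hp
    have h1 := one_sub_add_le_mul (α := 2 * ((t : ℝ) * m / N)) (β := (t : ℝ) ^ 2 / m)
      ((sub_le_sub_left hα 1).trans hq) hp (by positivity) hp1 (by positivity)
    have h2 := one_sub_add_le_mul (β := t / ((N : ℝ) + 1 - t)) h1 hr.ge hr0 hr1 (by positivity)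
    linarith
  · rw [hmin]
    refine le_trans ?_ (mul_le_mul_of_nonneg_left hdr (by positivity))
    have hs := one_sub_le_descFactorial_div (a := N) (b := N + t) (t := t)
      (D := ((N + t - 1).descFactorial t : ℝ)) (by omega) (by omega)
      (Nat.cast_pos.2 (Nat.descFactorial_pos.2 (by omega)))
      (by exact_mod_cast (Nat.descFactorial_le_pow _ _).trans
            (Nat.pow_le_pow_left (by omega) t))
    have p3 : (t.factorial : ℝ) ≠ 0 := Nat.cast_ne_zero.2 (Nat.factorial_ne_zero _)
    rw [Nat.descFactorial_eq_factorial_mul_choose, Nat.descFactorial_eq_factorial_mul_choose,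
      Nat.cast_mul, Nat.cast_mul, mul_div_mul_left _ _ p3] at hs
    rw [← mul_assoc, ← div_eq_inv_mul]
    have hα : (t : ℝ) * ((((N + t : ℕ) : ℝ) - N + t) / (N + t : ℕ)) ≤ 2 * ((t : ℝ) ^ 2 / m) := by
      push_cast
      rw [show (N : ℝ) + t - N + t = 2 * t by ring,
        show (t : ℝ) * (2 * t / (N + t)) = 2 * (t ^ 2 / (N + t)) by ring]
      gcongr
      linarith
    have h2 := one_sub_add_le_mul (α := 2 * ((t : ℝ) ^ 2 / m)) (β := t / ((N : ℝ) + 1 - t))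
      ((sub_le_sub_left hα 1).trans hs) hr.ge hr0 hr1 (by positivity)
    linarith

end Estimates

/-- The explicit bound on the trace distance, for all `t ≤ m ≤ N / 4`. -/
theorem traceDistance_le {X : Type} [Fintype X] [DecidableEq X] {t m : ℕ} (hm : 0 < m)
    (htm : t ≤ m) (hmN : 4 * m ≤ Fintype.card X) :
    traceDistance (subsetAverage X m t) (haarAverage X t) ≤
      4 * ((t : ℝ) * m / Fintype.card X) + 2 * ((t : ℝ) ^ 2 / m) := by
  have : Nonempty X := Fintype.card_pos_iff.1 (by omega)
  have h1 := traceDistance_subsetAverage_haarAverage_le (X := X) (t := t) hm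
    (by omega) (by omega) (by omega)
  have h2 := one_sub_le_min_mul hm htm hmN (choose_le_finrank_harmonicSubspace X t)
    (card_subtype_card_add_one_mul X)
  linarith

end SubsetState

theorem theorem1 :
    (∀ n t : ℕ,
      Matrix.toEuclideanCLM (𝕜 := ℂ) (SubsetState.haarAverage (Fin n → Bool) t) =
        (((2 ^ n + t - 1).choose t : ℂ))⁻¹ •
          (SubsetState.symSubspace (Fin n → Bool) t).starProjection) ∧
    ∃ C₁ C₂ : ℝ, 0 < C₁ ∧ 0 < C₂ ∧
      ∀ t m : ℕ → ℕ,
        (∃ k : ℕ, (fun n : ℕ => (t n : ℝ)) =O[atTop] (fun n : ℕ => (n : ℝ) ^ k)) →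
        (∀ k : ℕ, (fun n : ℕ => (n : ℝ) ^ k) =o[atTop] (fun n : ℕ => (m n : ℝ))) →
        (fun n : ℕ => (m n : ℝ)) =o[atTop] (fun n : ℕ => (2 : ℝ) ^ n) →
        ∀ᶠ n in atTop,
          SubsetState.traceDistance
              (SubsetState.subsetAverage (Fin n → Bool) (m n) (t n))
              (SubsetState.haarAverage (Fin n → Bool) (t n)) ≤
            C₁ * ((t n : ℝ) * (m n : ℝ) / (2 : ℝ) ^ n) + C₂ * ((t n : ℝ) ^ 2 / (m n : ℝ)) := by
  have hcard : ∀ n, Fintype.card (Fin n → Bool) = 2 ^ n := fun n => by simp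
  refine ⟨fun n t => ?_, 4, 2, by norm_num, by norm_num, ?_⟩
  · rw [SubsetState.toEuclideanCLM_haarAverage, hcard]
  · rintro t m ⟨k, hk⟩ hm hm2
    -- The growth hypotheses serve only to give `0 < m`, `t ≤ m` and `4m ≤ 2 ^ n` eventually.
    have h1 := (hm 0).bound one_pos
    have h2 := (hk.trans_isLittleO (hm k)).bound one_pos
    have h3 := hm2.bound (show (0 : ℝ) < 1 / 4 by norm_num)
    filter_upwards [h1, h2, h3] with n hn1 hn2 hn3
    simp only [pow_zero, norm_one, one_mul, Real.norm_natCast] at hn1 hn2 hn3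
    rw [Real.norm_of_nonneg (by positivity)] at hn3
    have e1 : 0 < m n := by exact_mod_cast (zero_lt_one.trans_le hn1)
    have e2 : t n ≤ m n := by exact_mod_cast hn2
    have e3 : 4 * m n ≤ 2 ^ n := by
      have : 4 * (m n : ℝ) ≤ 2 ^ n := by linarith
      exact_mod_cast this
    have h := SubsetState.traceDistance_le (X := Fin n → Bool) e1 e2 (by rw [hcard]; exact e3)
    rw [hcard] at h
    push_cast at h
    exact h
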